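/- A *cut* in a finite digraph $D=(V,A)$ is a set of arcs of the form $\{uv\in A : u\in U,\ v\notin U\}$ with $U\subseteq V$; $D$ is *covered by $k$ cuts* if $A$ is the union of $k$ cuts. For integers $\Delta^-,\Delta^+\ge -1$, let $\mathcal D(\Delta^-,\Delta^+)$ be the class of all finite acyclic digraphs in which every vertex has indegree at most $\Delta^-$ or outdegree at most $\Delta^+$, and let $c(\Delta^-,\Delta^+)$ be the smallest $k\in\{0,1,2,\dots\}$ such that every digraph in $\mathcal D(\Delta^-,\Delta^+)$ is covered by $k$ cuts. **Theorem.** $$c(5,2)\le 4,\qquad c(3,3)\le 4,\qquad c(6,-1)>4,\qquad c(4,3)>4.$$ Moreover, for all integers $\Delta^-,\Delta^+\ge -1$, we have $c(\Delta^-,\Delta^+)\le 4$ if and only if $$(\Delta^-\le 5\text{ and }\Delta^+\le 2)\quad\text{or}\quad(\Delta^-\le 2\text{ and }\Delta^+\le 5)\quad\text{or}\quad(\Delta^-\le 3\text{ and }\Delta^+\le 3).$$ -/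

import Mathlib

namespace Digraph

/-- The set of arcs of a digraph, an arc from `u` to `v` being the pair `(u, v)`. -/
def arcs {V : Type*} (D : Digraph V) : Set (V × V) :=
  {e | D.Adj e.1 e.2}

/-- The cut given by a vertex set `U`: all arcs that lead from `U` to its complement. -/
def cut {V : Type*} (D : Digraph V) (U : Set V) : Set (V × V) :=
  {e | e ∈ D.arcs ∧ e.1 ∈ U ∧ e.2 ∉ U}

/-- The arc set of the digraph is covered by `k` cuts. -/
def CoveredByCuts {V : Type*} (D : Digraph V) (k : ℕ) : Prop :=
  ∃ U : Fin k → Set V, D.arcs ⊆ ⋃ a, D.cut (U a)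

/-- There is no directed cycle (in particular no loop): no directed walk of positive length
leads from a vertex back to itself. -/
def Acyclic {V : Type*} (D : Digraph V) : Prop :=
  ∀ v, ¬ Relation.TransGen D.Adj v v

/-- Indegree of a vertex (used for digraphs on finite vertex sets). -/
noncomputable def indeg {V : Type*} (D : Digraph V) (v : V) : ℕ :=
  {u | D.Adj u v}.ncard

/-- Outdegree of a vertex (used for digraphs on finite vertex sets). -/
noncomputable def outdeg {V : Type*} (D : Digraph V) (v : V) : ℕ :=
  {w | D.Adj v w}.ncard

/-- Membership in the class `𝒟(Δ⁻, Δ⁺)`: the digraph is acyclic and every vertex has indegree at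
most `Δ⁻` or outdegree at most `Δ⁺`. The bounds are integers, since `-1` (a bound that no vertex
meets) is allowed. -/
def InClass {V : Type*} (D : Digraph V) (Δin Δout : ℤ) : Prop :=
  D.Acyclic ∧ ∀ v, (D.indeg v : ℤ) ≤ Δin ∨ (D.outdeg v : ℤ) ≤ Δout

/-- Every finite digraph in `𝒟(Δ⁻, Δ⁺)` is covered by `k` cuts. Every finite digraph is
isomorphic to one whose vertex type lives in `Type`. -/
def ClassCoveredByCuts (Δin Δout : ℤ) (k : ℕ) : Prop :=
  ∀ (V : Type) [Finite V] (D : Digraph V), D.InClass Δin Δout → D.CoveredByCuts k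

/-- `c(Δ⁻, Δ⁺)`: the smallest `k` such that every finite digraph in `𝒟(Δ⁻, Δ⁺)` is covered by
`k` cuts. The value is an extended natural number: it would be `⊤` if there were no such `k`. -/
noncomputable def cutCoverNumber (Δin Δout : ℤ) : ℕ∞ :=
  sInf {n : ℕ∞ | ∃ k : ℕ, n = k ∧ ClassCoveredByCuts Δin Δout k}

end Digraph

/-! Label each vertex by the set of cuts whose side `U` contains it: covering by four cuts means
that no tail label in `Finset (Fin 4)` is contained in its head label. Reversing arcs and
complementing labels exchanges the two bounds.

Upper bounds: greedy labelling. Vertices of small indegree are treated along the arcs, the others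
against them, with palettes chosen so that mixed arcs cause no conflict. For `(3, 3)` the palettes
are `headLabel` and `tailLabel`; for `(5, 2)` they are the six pairs and the four singletons.

Lower bounds: bounded indegree `k` can force an antichain of `k + 1` labels
(`exists_forces_antichain`). For `k = 6` this contradicts Sperner's theorem. For `(4, 3)`, five
incomparable source labels must be pairs; they leave the sinks only labels that are small or one
exceptional pair, so all singletons occur there, and a gadget between the two sides gives two
adjacent vertices the same label. -/

namespace Digraph

/-! ### Cut labellings, reversal and monotonicity -/

/-- The digraph with all arcs reversed. -/
def rev {V : Type*} (D : Digraph V) : Digraph V :=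
  ⟨fun u v => D.Adj v u⟩

/-- A labelling of the vertices by sets of cut indices such that no tail label is contained in the
head label. -/
def CutLabelling {V : Type*} (D : Digraph V) {k : ℕ} (f : V → Finset (Fin k)) : Prop :=
  ∀ u v, D.Adj u v → ¬ f u ⊆ f v

theorem coveredByCuts_iff {V : Type*} (D : Digraph V) (k : ℕ) :
    D.CoveredByCuts k ↔ ∃ f : V → Finset (Fin k), D.CutLabelling f := by
  classical
  constructor
  · rintro ⟨U, hU⟩
    refine ⟨fun v => Finset.univ.filter fun a => v ∈ U a, fun u v huv hs => ?_⟩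
    obtain ⟨a, -, hu, hv⟩ := Set.mem_iUnion.1 (hU (show (u, v) ∈ D.arcs from huv))
    have := hs (Finset.mem_filter.2 ⟨Finset.mem_univ a, hu⟩)
    exact hv (Finset.mem_filter.1 this).2
  · rintro ⟨f, hf⟩
    refine ⟨fun a => {v | a ∈ f v}, ?_⟩
    rintro ⟨u, v⟩ huv
    obtain ⟨a, hu, hv⟩ := Finset.not_subset.1 (hf u v huv)
    exact Set.mem_iUnion.2 ⟨a, huv, hu, hv⟩

theorem CutLabelling.rev_compl {V : Type*} {D : Digraph V} {k : ℕ} {f : V → Finset (Fin k)}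
    (hf : D.CutLabelling f) : D.rev.CutLabelling fun v => (f v)ᶜ := by
  intro u v huv hs
  exact hf v u huv (Finset.compl_subset_compl.1 hs)

theorem Acyclic.rev {V : Type*} {D : Digraph V} (hD : D.Acyclic) : D.rev.Acyclic := by
  intro v hv
  exact hD v (Relation.transGen_swap.1 hv)

theorem InClass.rev {V : Type*} {D : Digraph V} {m n : ℤ} (hD : D.InClass m n) :
    D.rev.InClass n m :=
  ⟨hD.1.rev, fun v => (hD.2 v).symm⟩

theorem InClass.mono {V : Type*} {D : Digraph V} {m n m' n' : ℤ} (hD : D.InClass m n)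
    (hm : m ≤ m') (hn : n ≤ n') : D.InClass m' n' :=
  ⟨hD.1, fun v => (hD.2 v).imp (fun h => h.trans hm) fun h => h.trans hn⟩

theorem ClassCoveredByCuts.mono {m n m' n' : ℤ} {k : ℕ} (h : ClassCoveredByCuts m' n' k)
    (hm : m ≤ m') (hn : n ≤ n') : ClassCoveredByCuts m n k :=
  fun V _ D hD => h V D (hD.mono hm hn)

theorem ClassCoveredByCuts.symm {m n : ℤ} {k : ℕ} (h : ClassCoveredByCuts m n k) :
    ClassCoveredByCuts n m k := by
  intro V _ D hD
  obtain ⟨f, hf⟩ := (coveredByCuts_iff _ _).1 (h V D.rev hD.rev)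
  exact (coveredByCuts_iff _ _).2 ⟨_, hf.rev_compl⟩

theorem ClassCoveredByCuts.mono_right {m n : ℤ} {k l : ℕ} (h : ClassCoveredByCuts m n k)
    (hkl : k ≤ l) : ClassCoveredByCuts m n l := by
  intro V _ D hD
  obtain ⟨f, hf⟩ := (coveredByCuts_iff _ _).1 (h V D hD)
  refine (coveredByCuts_iff _ _).2 ⟨fun v => (f v).map (Fin.castLEEmb hkl), fun u v huv hs => ?_⟩
  exact hf u v huv (Finset.map_subset_map.1 hs)

theorem cutCoverNumber_le_iff {m n : ℤ} {k : ℕ} :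
    cutCoverNumber m n ≤ k ↔ ClassCoveredByCuts m n k := by
  constructor
  · intro h
    have hne : {n' : ℕ∞ | ∃ k : ℕ, n' = k ∧ ClassCoveredByCuts m n k}.Nonempty := by
      by_contra hemp
      rw [Set.not_nonempty_iff_eq_empty] at hemp
      rw [cutCoverNumber, hemp, sInf_empty] at h
      exact absurd h (by simp)
    obtain ⟨l, hl, hc⟩ := csInf_mem hne
    rw [cutCoverNumber, hl] at h
    exact hc.mono_right (by exact_mod_cast h)
  · intro h
    exact sInf_le ⟨k, rfl, h⟩

/-! ### Greedy choice on acyclic digraphs -/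

/-- Greedy choice along a well-founded relation. -/
theorem exists_greedy {V C : Type*} [Nonempty C] {r : V → V → Prop} (hr : WellFounded r)
    (P : V → (V → C) → C → Prop) (hex : ∀ v g, ∃ c, P v g c)
    (hloc : ∀ v g g' c, (∀ u, r u v → g u = g' u) → P v g c → P v g' c) :
    ∃ f : V → C, ∀ v, P v f (f v) := by
  classical
  obtain ⟨c₀⟩ := ‹Nonempty C›
  -- The default `c₀` off the predecessors of `v` is harmless: by `hloc` only values at predecessors
  -- matter.
  let ext (v : V) (ih : ∀ u, r u v → C) : V → C := fun u => if h : r u v then ih u h else c₀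
  let f : V → C := hr.fix fun v ih => (hex v (ext v ih)).choose
  have hf : ∀ v, f v = (hex v (ext v fun u _ => f u)).choose := fun v => hr.fix_eq _ v
  refine ⟨f, fun v => hloc v (ext v fun u _ => f u) f (f v) (fun u hu => ?_) ?_⟩
  · simp [ext, hu]
  · rw [hf v]
    exact (hex v _).choose_spec

theorem Acyclic.wellFounded {V : Type*} [Finite V] {D : Digraph V} (hD : D.Acyclic) :
    WellFounded D.Adj := by
  have : Std.Irrefl (Relation.TransGen D.Adj) := ⟨hD⟩
  exact Subrelation.wf (fun h => Relation.TransGen.single h)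
    (Finite.wellFounded_of_trans_of_irrefl (Relation.TransGen D.Adj))

theorem Acyclic.of_rank {V : Type*} {D : Digraph V} (r : V → ℕ)
    (hr : ∀ u v, D.Adj u v → r u < r v) : D.Acyclic := by
  intro v hv
  have : ∀ u w, Relation.TransGen D.Adj u w → r u < r w := by
    intro u w h
    induction h with
    | single h => exact hr _ _ h
    | tail _ h ih => exact ih.trans (hr _ _ h)
  exact lt_irrefl _ (this v v hv)

theorem exists_notMem_image_of_indeg_lt {V C : Type*} [Finite V] [Fintype C] (D : Digraph V)
    (v : V) (h : D.indeg v < Fintype.card C) (φ : V → C) : ∃ c, ∀ u, D.Adj u v → φ u ≠ c := by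
  by_contra! hall
  have hsub : (Set.univ : Set C) ⊆ φ '' {u | D.Adj u v} := fun c _ => hall c
  have h1 := Set.ncard_le_ncard hsub
  have h2 := Set.ncard_image_le (f := φ) (Set.toFinite {u | D.Adj u v})
  rw [Set.ncard_univ, Nat.card_eq_fintype_card] at h1
  unfold indeg at h
  omega

/-! ### Upper bound for `(3, 3)` -/

/-- If the vertices in `A` have indegree at most 3, then four colours suffice for a proper colouring
of `A` in which vertices with an in-neighbour outside `A` avoid the colour `0`. -/
theorem Acyclic.exists_colouring_avoiding_zero {V : Type*} [Finite V] {D : Digraph V}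
    (hD : D.Acyclic) (A : Set V) (hA : ∀ v ∈ A, D.indeg v ≤ 3) :
    ∃ f : V → Fin 4, ∀ v ∈ A, ∀ u, D.Adj u v → (u ∈ A → f u ≠ f v) ∧ (u ∉ A → f v ≠ 0) := by
  classical
  refine exists_greedy hD.wellFounded
    (fun v g c => v ∈ A → ∀ u, D.Adj u v → (u ∈ A → g u ≠ c) ∧ (u ∉ A → c ≠ 0)) ?_ ?_
  · intro v g
    by_cases hv : v ∈ A
    -- In-neighbours outside `A` all block the colour `0`, so at most three colours are blocked.
    · obtain ⟨c, hc⟩ := D.exists_notMem_image_of_indeg_lt v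
        ((hA v hv).trans_lt (by simp : 3 < Fintype.card (Fin 4))) fun u => if u ∈ A then g u else 0
      refine ⟨c, fun _ u hu => ⟨fun h => ?_, fun h => ?_⟩⟩
      · simpa [h] using hc u hu
      · simpa [h] using (hc u hu).symm
    · exact ⟨0, fun h => absurd h hv⟩
  · intro v g g' c hg h hv u hu
    rw [← hg u hu]
    exact h hv u hu

/-- The labels of the vertices of small indegree. -/
def headLabel : Fin 4 → Finset (Fin 4) :=
  ![{0, 1, 2}, {0, 3}, {1, 3}, {2, 3}]

/-- The labels of the vertices of small outdegree. -/
def tailLabel : Fin 4 → Finset (Fin 4) :=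
  ![{3}, {1, 2}, {0, 2}, {0, 1}]

theorem headLabel_not_subset : ∀ i j, i ≠ j → ¬ headLabel i ⊆ headLabel j := by decide

theorem tailLabel_not_subset : ∀ i j, i ≠ j → ¬ tailLabel i ⊆ tailLabel j := by decide

theorem headLabel_not_subset_tailLabel : ∀ i j, ¬ headLabel i ⊆ tailLabel j := by decide

/-- Colour `0` must be excluded on both sides: `{3}` lies in every head pair, and `{0, 1, 2}`
contains every tail pair. -/
theorem tailLabel_not_subset_headLabel :
    ∀ i j, i ≠ 0 → j ≠ 0 → ¬ tailLabel i ⊆ headLabel j := by decide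

theorem classCoveredByCuts_three_three : ClassCoveredByCuts 3 3 4 := by
  classical
  intro V _ D hD
  refine (coveredByCuts_iff _ _).2 ?_
  let A : Set V := {v | D.indeg v ≤ 3}
  have hB : ∀ v ∈ Aᶜ, D.rev.indeg v ≤ 3 := fun v hv => by
    rcases hD.2 v with h | h
    · exact absurd (by exact_mod_cast h : D.indeg v ≤ 3) hv
    · exact_mod_cast h
  obtain ⟨f, hf⟩ := hD.1.exists_colouring_avoiding_zero A fun v hv => hv
  obtain ⟨g, hg⟩ := hD.1.rev.exists_colouring_avoiding_zero Aᶜ hB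
  refine ⟨fun v => if v ∈ A then headLabel (f v) else tailLabel (g v), fun u v huv => ?_⟩
  by_cases hu : u ∈ A <;> by_cases hv : v ∈ A <;> simp only [hu, hv, if_true, if_false]
  · exact headLabel_not_subset _ _ ((hf v hv u huv).1 hu)
  · exact headLabel_not_subset_tailLabel _ _
  · exact tailLabel_not_subset_headLabel _ _ ((hg u hu v huv).2 (by simpa using hv))
      ((hf v hv u huv).2 hu)
  · exact tailLabel_not_subset _ _ ((hg u hu v huv).1 hv).symm

/-! ### Upper bound for `(5, 2)` -/

theorem eq_of_outdeg_le_two {V : Type*} [Finite V] {D : Digraph V} {w u u' v : V}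
    (hw : D.outdeg w ≤ 2) (hu : D.Adj w u) (hu' : D.Adj w u') (hv : D.Adj w v) (huv : u ≠ v)
    (huv' : u' ≠ v) : u = u' := by
  by_contra hne
  have hsub : ({u, u', v} : Set V) ⊆ {x | D.Adj w x} := by
    rintro x (rfl | rfl | rfl) <;> assumption
  have h1 := Set.ncard_le_ncard hsub
  rw [Set.ncard_eq_three.2 ⟨u, u', v, hne, huv, huv', rfl⟩] at h1
  unfold outdeg at hw
  omega

/-- The number of ancestors increases along arcs, and an enumeration of `V` breaks ties. Injectivity
decides which of two heads with a common in-neighbour is labelled first. -/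
theorem Acyclic.exists_injective_rank {V : Type*} [Finite V] {D : Digraph V} (hD : D.Acyclic) :
    ∃ r : V → ℕ, Function.Injective r ∧ ∀ u v, D.Adj u v → r u < r v := by
  let n := Nat.card V
  let e : V ≃ Fin n := Finite.equivFin V
  let d : V → ℕ := fun v => {x | Relation.TransGen D.Adj x v}.ncard
  have hd : ∀ u v, D.Adj u v → d u < d v := fun u v huv => by
    refine Set.ncard_lt_ncard ⟨fun x hx => Relation.TransGen.tail hx huv, fun h => ?_⟩
    exact hD u (h (Relation.TransGen.single huv))
  refine ⟨fun v => n * d v + e v, fun u v huv => ?_, fun u v huv => ?_⟩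
  · have h := congrArg (· % n) huv
    simp only [Nat.mul_add_mod, Nat.mod_eq_of_lt (e _).2] at h
    exact e.injective (Fin.ext h)
  · have h1 : n * d u + n ≤ n * d v := by
      rw [← Nat.mul_succ]
      exact Nat.mul_le_mul_left n (hd u v huv)
    have h2 := (e u).2
    show n * d u + e u < n * d v + e v
    omega

/-- A partial labelling by pairs for the vertices of indegree at most 5. -/
theorem Acyclic.exists_pair_labelling {V : Type*} [Finite V] {D : Digraph V}
    (hD : D.Acyclic) (A : Set V) (hA : ∀ v ∈ A, D.indeg v ≤ 5) (hB : ∀ v ∉ A, D.outdeg v ≤ 2) :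
    ∃ f : V → Finset (Fin 4), (∀ v, (f v).card = 2) ∧
      (∀ v ∈ A, ∀ u ∈ A, D.Adj u v → f u ≠ f v) ∧
      ∀ v ∈ A, ∀ u ∈ A, u ≠ v → ∀ w ∉ A, D.Adj w u → D.Adj w v → f v ≠ (f u)ᶜ := by
  classical
  let C := {s : Finset (Fin 4) // s.card = 2}
  have hcard : Fintype.card C = 6 := by
    simp only [C]
    rw [Fintype.card_finset_len]
    rfl
  let co : C → C := fun s => ⟨s.1ᶜ, by rw [Finset.card_compl, s.2]; rfl⟩
  have hco : ∀ s, co (co s) = s := fun s => Subtype.ext (compl_compl s.1)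
  obtain ⟨r, hr, hadj⟩ : ∃ r : V → ℕ, Function.Injective r ∧ ∀ u v, D.Adj u v → r u < r v :=
    hD.exists_injective_rank
  have hne : Nonempty C := Fintype.card_pos_iff.1 (by omega)
  let P : V → (V → C) → C → Prop := fun v g c => v ∈ A → ∀ u ∈ A, r u < r v →
    (D.Adj u v → g u ≠ c) ∧ ∀ w ∉ A, D.Adj w u → D.Adj w v → co (g u) ≠ c
  obtain ⟨f, hf⟩ : ∃ f : V → C, ∀ v, P v f (f v) := by
    refine exists_greedy (r := fun u v => r u < r v) (InvImage.wf r wellFounded_lt) P ?_ ?_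
    · intro v g
      by_cases hv : v ∈ A
      -- Each in-neighbour `w` blocks one of the six pairs: its own label if `w ∈ A`, otherwise the
      -- complement of the label of its only other out-neighbour, if there is one.
      · let φ : V → C := fun w => if w ∈ A then g w else
          if h : ∃ u, D.Adj w u ∧ u ≠ v then co (g h.choose) else g w
        obtain ⟨c, hc⟩ := D.exists_notMem_image_of_indeg_lt v
          ((hA v hv).trans_lt (by omega : 5 < Fintype.card C)) φ
        refine ⟨c, fun _ u hu huv => ⟨fun h => ?_, fun w hw hwu hwv => ?_⟩⟩
        · simpa [φ, hu] using hc u h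
        · have huv' : u ≠ v := fun h => by simp [h] at huv
          have hex : ∃ u, D.Adj w u ∧ u ≠ v := ⟨u, hwu, huv'⟩
          have hch : hex.choose = u :=
            eq_of_outdeg_le_two (hB w hw) hex.choose_spec.1 hwu hwv hex.choose_spec.2 huv'
          have := hc w hwv
          simp only [φ, hw, if_false, dif_pos hex] at this
          rwa [hch] at this
      · exact ⟨hne.some, fun h => absurd h hv⟩
    · intro v g g' c hg h hv u hu huv
      rw [← hg u huv]
      exact h hv u hu huv
  refine ⟨fun v => (f v).1, fun v => (f v).2, fun v hv u hu huv h => ?_,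
    fun v hv u hu hne w hw hwu hwv h => ?_⟩
  · exact (hf v hv u hu (hadj u v huv)).1 huv (Subtype.ext h)
  · have h' : co (f u) = f v := Subtype.ext h.symm
    rcases lt_or_gt_of_ne (hr.ne hne) with hlt | hlt
    · exact (hf v hv u hu hlt).2 w hw hwu hwv h'
    · exact (hf u hu v hv hlt).2 w hw hwv hwu (by rw [← h', hco])

/-- Two out-neighbours can block all four singletons only if they carry complementary pairs, which
`hf'` rules out. -/
theorem Acyclic.exists_singleton_labelling {V : Type*} [Finite V] {D : Digraph V}
    (hD : D.Acyclic) (A : Set V) (hB : ∀ v ∉ A, D.outdeg v ≤ 2) (f : V → Finset (Fin 4))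
    (hf : ∀ v, (f v).card = 2)
    (hf' : ∀ v ∈ A, ∀ u ∈ A, u ≠ v → ∀ w ∉ A, D.Adj w u → D.Adj w v → f v ≠ (f u)ᶜ) :
    ∃ g : V → Fin 4, ∀ v ∉ A, ∀ w, D.Adj v w → (w ∈ A → g v ∉ f w) ∧ (w ∉ A → g v ≠ g w) := by
  classical
  refine exists_greedy hD.rev.wellFounded
    (fun v g c => v ∉ A → ∀ w, D.Adj v w → (w ∈ A → c ∉ f w) ∧ (w ∉ A → c ≠ g w)) ?_ ?_
  · intro v g
    by_cases hv : v ∈ A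
    · exact ⟨0, fun h => absurd hv h⟩
    · let F : V → Finset (Fin 4) := fun w => if w ∈ A then f w else {g w}
      have hF : ∀ w, (F w).card ≤ 2 := fun w => by
        by_cases hw : w ∈ A <;> simp [F, hw, hf]
      have hpair : ∀ u w, D.Adj v u → D.Adj v w → F u ∪ F w ≠ Finset.univ := by
        intro u w hu hw huw
        have hc : (F u ∪ F w).card = 4 := by rw [huw]; rfl
        have hle := Finset.card_union_le (F u) (F w)
        have h1 := hF u
        have h2 := hF w
        have hne : u ≠ w := by
          rintro rfl
          rw [Finset.union_self] at hc
          omega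
        have huA : u ∈ A := by
          by_contra h
          have : (F u).card = 1 := by simp [F, h]
          omega
        have hwA : w ∈ A := by
          by_contra h
          have : (F w).card = 1 := by simp [F, h]
          omega
        refine hf' w hwA u huA hne v hv hu hw ?_
        simp only [F, huA, hwA, if_true] at huw
        symm
        refine Finset.eq_of_subset_of_card_le (fun x hx => ?_) ?_
        · have : x ∈ f u ∪ f w := huw ▸ Finset.mem_univ x
          exact (Finset.mem_union.1 this).resolve_left (Finset.mem_compl.1 hx)
        · rw [Finset.card_compl, hf, hf]; rfl
      have hex : ∃ c, ∀ w, D.Adj v w → c ∉ F w := by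
        have hcases : ∃ u w, {x | D.Adj v x} ⊆ {u, w} ∧ ({x | D.Adj v x} = ∅ ∨
            D.Adj v u ∧ D.Adj v w) := by
          have h2 : {x | D.Adj v x}.ncard ≤ 2 := hB v hv
          interval_cases h : {x | D.Adj v x}.ncard
          · rw [Set.ncard_eq_zero] at h
            exact ⟨v, v, by simp [h], Or.inl h⟩
          · obtain ⟨a, ha⟩ := Set.ncard_eq_one.1 h
            have : D.Adj v a := by
              change a ∈ {x | D.Adj v x}
              simp [ha]
            exact ⟨a, a, by simp [ha], Or.inr ⟨this, this⟩⟩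
          · obtain ⟨a, b, -, ha⟩ := Set.ncard_eq_two.1 h
            refine ⟨a, b, ha.subset, Or.inr ⟨?_, ?_⟩⟩
            · change a ∈ {x | D.Adj v x}
              simp [ha]
            · change b ∈ {x | D.Adj v x}
              simp [ha]
        obtain ⟨u, w, hsub, hem | ⟨hu, hw⟩⟩ := hcases
        · exact ⟨0, fun x hx => absurd (show x ∈ {x | D.Adj v x} from hx) (by simp [hem])⟩
        · obtain ⟨c, hc⟩ : ∃ c, c ∉ F u ∪ F w := by
            by_contra! h
            exact hpair u w hu hw (Finset.eq_univ_iff_forall.2 h)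
          rw [Finset.mem_union, not_or] at hc
          refine ⟨c, fun x hx => ?_⟩
          rcases hsub hx with rfl | rfl
          · exact hc.1
          · exact hc.2
      obtain ⟨c, hc⟩ := hex
      refine ⟨c, fun _ w hw => ⟨fun h => ?_, fun h => ?_⟩⟩
      · simpa [F, h] using hc w hw
      · simpa [F, h] using hc w hw
  · intro v g g' c hg h hv w hw
    rw [← hg w hw]
    exact h hv w hw

theorem classCoveredByCuts_five_two : ClassCoveredByCuts 5 2 4 := by
  classical
  intro V _ D hD
  refine (coveredByCuts_iff _ _).2 ?_
  let A : Set V := {v | D.indeg v ≤ 5}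
  have hB : ∀ v ∉ A, D.outdeg v ≤ 2 := fun v hv => by
    rcases hD.2 v with h | h
    · exact absurd (by exact_mod_cast h : D.indeg v ≤ 5) hv
    · exact_mod_cast h
  obtain ⟨f, hf, hfA, hfB⟩ := hD.1.exists_pair_labelling A (fun v hv => hv) hB
  obtain ⟨g, hg⟩ := hD.1.exists_singleton_labelling A hB f hf hfB
  refine ⟨fun v => if v ∈ A then f v else {g v}, fun u v huv => ?_⟩
  by_cases hu : u ∈ A <;> by_cases hv : v ∈ A <;> simp only [hu, hv, if_true, if_false]
  · exact fun h => hfA v hv u hu huv (Finset.eq_of_subset_of_card_le h (by rw [hf, hf]))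
  · intro h
    have := Finset.card_le_card h
    simp [hf] at this
  · simpa using (hg u hu v huv).1 hv
  · simpa using (hg u hu v huv).2 hv

/-! ### Forcing antichains, and the lower bound for `(6, -1)` -/

/-- Add to `D` a new vertex for each set of at most `k` old vertices, which becomes its set of
in-neighbours. -/
def addHeads {V : Type*} (D : Digraph V) (k : ℕ) :
    Digraph (V ⊕ {s : Finset V // s.card ≤ k}) :=
  ⟨fun x y => match x, y with
    | .inl u, .inl v => D.Adj u v
    | .inl u, .inr s => u ∈ s.1
    | .inr _, _ => False⟩

theorem addHeads_indeg_le {V : Type*} [Finite V] {D : Digraph V} {k : ℕ}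
    (hD : ∀ v, D.indeg v ≤ k) (x) : (D.addHeads k).indeg x ≤ k := by
  rcases x with v | s
  · have : {x | (D.addHeads k).Adj x (.inl v)} = Sum.inl '' {u | D.Adj u v} := by
      ext (u | t) <;> simp [addHeads]
    rw [indeg, this, Set.ncard_image_of_injective _ Sum.inl_injective]
    exact hD v
  · have : {x | (D.addHeads k).Adj x (.inr s)} = Sum.inl '' (s.1 : Set V) := by
      ext (u | t) <;> simp [addHeads]
    rw [indeg, this, Set.ncard_image_of_injective _ Sum.inl_injective, Set.ncard_coe_finset]
    exact s.2

/-- The minimal labels in use form an antichain. If there are at most `k` of them, a new head joined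
from carriers of all of them lies above no used label, so its own label is new. -/
theorem exists_antichain_or_many_labels (k l n : ℕ) :
    ∃ (V : Type) (_ : Finite V) (D : Digraph V) (r : V → ℕ), (∀ u v, D.Adj u v → r u < r v) ∧
      (∀ v, D.indeg v ≤ k) ∧ ∀ f : V → Finset (Fin l), D.CutLabelling f →
        (∃ M : Finset (Finset (Fin l)), k < M.card ∧ IsAntichain (· ⊆ ·) (M : Set (Finset (Fin l))) ∧
          ∀ m ∈ M, ∃ v, f v = m) ∨ n ≤ (Set.range f).ncard := by
  classical
  induction n with
  | zero =>
    exact ⟨Empty, inferInstance, ⟨fun _ _ => False⟩, fun _ => 0, by simp, by simp,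
      fun f _ => Or.inr (Nat.zero_le _)⟩
  | succ n ih =>
    obtain ⟨V, _, D, r, hr, hdeg, hforce⟩ := ih
    obtain ⟨N, hN⟩ := (Set.finite_range r).bddAbove
    refine ⟨_, inferInstance, D.addHeads k, Sum.elim r fun _ => N + 1, ?_,
      addHeads_indeg_le hdeg, fun f hf => ?_⟩
    · rintro (u | s) (v | t) h
      · exact hr u v h
      · exact Nat.lt_succ_of_le (hN ⟨u, rfl⟩)
      · exact h.elim
      · exact h.elim
    have hfl : D.CutLabelling (f ∘ Sum.inl) := fun u v huv => hf (.inl u) (.inl v) huv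
    rcases hforce _ hfl with ⟨M, hM, hanti, hmem⟩ | hn
    · exact Or.inl ⟨M, hM, hanti, fun m hm => (hmem m hm).imp' Sum.inl fun _ h => h⟩
    let F : Finset (Finset (Fin l)) := (Set.range (f ∘ Sum.inl)).toFinite.toFinset
    let M := F.filter (Minimal (· ∈ F))
    have hMF : ∀ m ∈ M, ∃ v : V, f (.inl v) = m := fun m hm => by
      simpa [F] using (Finset.mem_filter.1 hm).1
    rcases lt_or_ge k M.card with hk | hk
    · refine Or.inl ⟨M, hk, ?_, fun m hm => (hMF m hm).imp' Sum.inl fun _ h => h⟩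
      intro a ha b hb hab hle
      exact hab (hle.antisymm ((Finset.mem_filter.1 hb).2.le_of_le (Finset.mem_filter.1 ha).1 hle))
    · choose g hg using hMF
      let s : {s : Finset V // s.card ≤ k} := ⟨M.attach.image fun m => g m.1 m.2,
        Finset.card_image_le.trans (by rwa [Finset.card_attach])⟩
      have hs : f (.inr s) ∉ Set.range (f ∘ Sum.inl) := by
        intro hmem
        obtain ⟨m, hle, hm⟩ := F.exists_le_minimal (a := f (.inr s)) (by simpa [F] using hmem)
        have hmM : m ∈ M := Finset.mem_filter.2 ⟨hm.prop, hm⟩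
        have hadj : (D.addHeads k).Adj (.inl (g m hmM)) (.inr s) :=
          Finset.mem_image.2 ⟨⟨m, hmM⟩, Finset.mem_attach _ _, rfl⟩
        exact hf _ _ hadj (by rw [hg m hmM]; exact hle)
      refine Or.inr ?_
      have hins : insert (f (.inr s)) (Set.range (f ∘ Sum.inl)) ⊆ Set.range f := by
        rintro x (rfl | ⟨v, rfl⟩)
        · exact ⟨_, rfl⟩
        · exact ⟨.inl v, rfl⟩
      have := Set.ncard_le_ncard hins
      rw [Set.ncard_insert_of_notMem hs] at this
      omega

/-- Some acyclic digraph of maximum indegree `k` forces an antichain of `k + 1` labels. -/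
theorem exists_forces_antichain (k l : ℕ) :
    ∃ (V : Type) (_ : Finite V) (D : Digraph V) (r : V → ℕ), (∀ u v, D.Adj u v → r u < r v) ∧
      (∀ v, D.indeg v ≤ k) ∧ ∀ f : V → Finset (Fin l), D.CutLabelling f →
        ∃ M : Finset (Finset (Fin l)), k < M.card ∧ IsAntichain (· ⊆ ·) (M : Set (Finset (Fin l))) ∧
          ∀ m ∈ M, ∃ v, f v = m := by
  obtain ⟨V, hV, D, r, hr, hdeg, hforce⟩ :=
    -- One more than the number of labels, so the second alternative is impossible.
    exists_antichain_or_many_labels k l (Fintype.card (Finset (Fin l)) + 1)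
  refine ⟨V, hV, D, r, hr, hdeg, fun f hf => (hforce f hf).resolve_right fun h => ?_⟩
  have := Set.ncard_le_card (Set.range f)
  rw [Nat.card_eq_fintype_card] at this
  omega

theorem not_classCoveredByCuts_six : ¬ ClassCoveredByCuts 6 (-1) 4 := by
  intro h
  obtain ⟨V, _, D, r, hr, hdeg, hforce⟩ := exists_forces_antichain 6 4
  obtain ⟨f, hf⟩ := (coveredByCuts_iff _ _).1
    (h V D ⟨Acyclic.of_rank r hr, fun v => Or.inl (by exact_mod_cast hdeg v)⟩)
  obtain ⟨M, hM, hanti, -⟩ := hforce f hf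
  have hM' : M.card ≤ 6 := by simpa [Nat.choose] using hanti.sperner
  omega

/-! ### Antichains of five labels -/

/-- For a label `m` of size 1 or 3, an index of a chain (of three that cover the labels incomparable
with `m`) which contains `s`. -/
def chainIndex (m s : Finset (Fin 4)) : Fin 3 :=
  let i : Fin 4 := if m = {0} ∨ m = {0}ᶜ then 0 else if m = {1} ∨ m = {1}ᶜ then 1 else
    if m = {2} ∨ m = {2}ᶜ then 2 else 3
  -- With `a, b, c = i + 1, i + 2, i + 3`, the traces of `s` on `{a, b, c}` form the chains `∅ ⊂ a ⊂
  -- ab ⊂ abc`, `b ⊂ bc` and `c ⊂ ac`.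
  if i + 1 ∈ s ∧ ¬ (i + 3 ∈ s ∧ i + 2 ∉ s) then 0 else if i + 2 ∈ s then 1 else
    if i + 3 ∈ s then 2 else 0

set_option maxRecDepth 20000 in
set_option maxHeartbeats 2000000 in
theorem comparable_of_chainIndex_eq : ∀ m : Finset (Fin 4), m.card ≠ 2 →
    ∀ s, ¬ m ⊆ s → ¬ s ⊆ m → ∀ t, ¬ m ⊆ t → ¬ t ⊆ m → chainIndex m s = chainIndex m t →
      s ⊆ t ∨ t ⊆ s := by
  decide

/-- Three chains cover the labels incomparable with an `m` of another size, so an antichain through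
`m` has at most four members. -/
theorem card_eq_two_of_antichain {M : Finset (Finset (Fin 4))} (hM : 4 < M.card)
    (hanti : IsAntichain (· ⊆ ·) (M : Set (Finset (Fin 4)))) : ∀ m ∈ M, m.card = 2 := by
  intro m hm
  by_contra h2
  have hcard : (M.erase m).card ≤ (Finset.univ : Finset (Fin 3)).card := by
    refine Finset.card_le_card_of_injOn (chainIndex m) (fun _ _ => Finset.mem_coe.2 (Finset.mem_univ _)) ?_
    intro s hs t ht hst
    obtain ⟨hsm, hs⟩ := Finset.mem_erase.1 (Finset.mem_coe.1 hs)
    obtain ⟨htm, ht⟩ := Finset.mem_erase.1 (Finset.mem_coe.1 ht)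
    by_contra hne
    rcases comparable_of_chainIndex_eq m h2 s (hanti hm hs hsm.symm) (hanti hs hm hsm) t
      (hanti hm ht htm.symm) (hanti ht hm htm) hst with h | h
    · exact hanti hs ht hne h
    · exact hanti ht hs (Ne.symm hne) h
  rw [Finset.card_erase_of_mem hm, Finset.card_univ, Fintype.card_fin] at hcard
  omega

theorem exists_pair_of_antichain {M : Finset (Finset (Fin 4))} (hM : 4 < M.card)
    (hanti : IsAntichain (· ⊆ ·) (M : Set (Finset (Fin 4)))) :
    ∃ p q, p ≠ q ∧ ∀ s : Finset (Fin 4), s.card = 2 → s ≠ {p, q} → s ∈ M := by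
  have hsub : M ⊆ Finset.univ.powersetCard 2 := fun m hm =>
    Finset.mem_powersetCard.2 ⟨Finset.subset_univ m, card_eq_two_of_antichain hM hanti m hm⟩
  have hdiff : (Finset.univ.powersetCard 2 \ M).card ≤ 1 := by
    rw [Finset.card_sdiff_of_subset hsub, Finset.card_powersetCard]
    simp [Nat.choose]
    omega
  have hmem : ∀ s : Finset (Fin 4), s.card = 2 → s ∉ M → s ∈ Finset.univ.powersetCard 2 \ M :=
    fun s hs hsM => Finset.mem_sdiff.2
      ⟨Finset.mem_powersetCard.2 ⟨Finset.subset_univ s, hs⟩, hsM⟩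
  by_cases h : ∃ e : Finset (Fin 4), e.card = 2 ∧ e ∉ M
  · obtain ⟨e, he, heM⟩ := h
    obtain ⟨p, q, hpq, rfl⟩ := Finset.card_eq_two.1 he
    refine ⟨p, q, hpq, fun s hs hne => ?_⟩
    by_contra hsM
    exact hne (Finset.card_le_one.1 hdiff s (hmem s hs hsM) _ (hmem _ he heM))
  -- No pair is missing, so any distinct `p`, `q` serve.
  · push Not at h
    exact ⟨0, 1, by decide, fun s hs _ => h s hs⟩

/-! ### Lower bound for `(4, 3)` -/

theorem exists_forces_antichain_of_outdeg (k l : ℕ) :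
    ∃ (V : Type) (_ : Finite V) (D : Digraph V) (r : V → ℕ), (∀ u v, D.Adj u v → r u < r v) ∧
      (∀ v, D.outdeg v ≤ k) ∧ ∀ f : V → Finset (Fin l), D.CutLabelling f →
        ∃ M : Finset (Finset (Fin l)), k < M.card ∧ IsAntichain (· ⊆ ·) (M : Set (Finset (Fin l))) ∧
          ∀ m ∈ M, ∃ v, f v = m := by
  classical
  obtain ⟨V, hV, D, r, hr, hdeg, hforce⟩ := exists_forces_antichain k l
  obtain ⟨N, hN⟩ := (Set.finite_range r).bddAbove
  refine ⟨V, hV, D.rev, fun v => N - r v, fun u v huv => ?_, hdeg, fun f hf => ?_⟩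
  · have h1 := hr v u huv
    have h2 := hN ⟨u, rfl⟩
    show N - r u < N - r v
    omega
  · obtain ⟨M, hM, hanti, hmem⟩ := hforce _ hf.rev_compl
    refine ⟨M.image compl, ?_, ?_, fun m hm => ?_⟩
    · rwa [Finset.card_image_of_injective _ compl_injective]
    · rw [Finset.coe_image]
      rintro _ ⟨a, ha, rfl⟩ _ ⟨b, hb, rfl⟩ hab hle
      exact hanti hb ha (fun h => hab (by rw [h])) (Finset.compl_subset_compl.1 hle)
    · obtain ⟨a, ha, rfl⟩ := Finset.mem_image.1 hm
      obtain ⟨v, hv⟩ := hmem a ha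
      exact ⟨v, by rw [← hv, compl_compl]⟩

theorem card_le_one_or_eq_pair : ∀ p q : Fin 4, p ≠ q → ∀ n : Finset (Fin 4),
    (∀ s, s ⊆ n → s.card = 2 → s = {p, q}) → n.card ≤ 1 ∨ n = {p, q} := by
  decide

/-- Members of `N` are nonempty and pairwise disjoint, and four such subsets of `Fin 4` must be the
singletons. -/
theorem singleton_mem_of_antichain {p q : Fin 4} {N : Finset (Finset (Fin 4))}
    (hN : 3 < N.card) (hanti : IsAntichain (· ⊆ ·) (N : Set (Finset (Fin 4))))
    (hsmall : ∀ n ∈ N, n.card ≤ 1 ∨ n = {p, q}) (i : Fin 4) : {i} ∈ N := by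
  have hne : ∀ n ∈ N, n.Nonempty := by
    intro n hn
    rw [Finset.nonempty_iff_ne_empty]
    rintro rfl
    obtain ⟨m, hm, hne⟩ := Finset.exists_mem_ne (by omega : 1 < N.card) ∅
    exact hanti hn hm hne.symm (Finset.empty_subset m)
  choose h hh using hne
  have heq : ∀ n ∈ N, ∀ n' ∈ N, ∀ x, x ∈ n → x ∈ n' → n = n' := by
    intro n hn n' hn' x hx hx'
    by_contra hne
    have single : ∀ m : Finset (Fin 4), m.card ≤ 1 → x ∈ m → m = {x} := fun m hm hxm =>
      Finset.eq_singleton_iff_unique_mem.2 ⟨hxm, fun y hy => Finset.card_le_one.1 hm y hy x hxm⟩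
    rcases hsmall n hn with h1 | h1
    · rw [single n h1 hx] at hne hn
      exact hanti hn hn' hne (Finset.singleton_subset_iff.2 hx')
    · rcases hsmall n' hn' with h2 | h2
      · rw [single n' h2 hx'] at hne hn'
        exact hanti hn' hn (Ne.symm hne) (Finset.singleton_subset_iff.2 hx)
      · exact hne (h1.trans h2.symm)
  have hinj : Function.Injective fun n : N => h n.1 n.2 := by
    rintro ⟨n, hn⟩ ⟨n', hn'⟩ hnn
    refine Subtype.ext (heq n hn n' hn' _ (hh n hn) ?_)
    have : h n hn = h n' hn' := hnn
    rw [this]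
    exact hh n' hn'
  have hsurj : Function.Surjective fun n : N => h n.1 n.2 := by
    refine ((Fintype.bijective_iff_injective_and_card _).2 ⟨hinj, ?_⟩).2
    have := Fintype.card_le_of_injective _ hinj
    rw [Fintype.card_coe, Fintype.card_fin] at *
    omega
  obtain ⟨⟨n, hn⟩, hi⟩ := hsurj i
  have hi : h n hn = i := hi
  have hin : i ∈ n := hi ▸ hh n hn
  have : n = {i} := by
    refine Finset.eq_singleton_iff_unique_mem.2 ⟨hin, fun j hj => ?_⟩
    obtain ⟨⟨n', hn'⟩, hj'⟩ := hsurj j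
    have hj' : h n' hn' = j := hj'
    have hnn : n' = n := heq n' hn' n hn j (hj' ▸ hh n' hn') hj
    subst hnn
    rw [← hj', hi]
  exact this ▸ hn

/-- The vertices of a digraph that is glued from digraphs on `A` and `B` and a gadget. -/
inductive GadgetVertex (A B : Type)
  | source (v : A)
  | guard (x y : B) (k : Bool)
  | link (k : Bool)
  | apex (k : Bool)
  | sink (v : B)

instance {A B : Type} [Finite A] [Finite B] : Finite (GadgetVertex A B) := by
  refine Finite.of_surjective (α := A ⊕ (B × B × Bool) ⊕ Bool ⊕ Bool ⊕ B)
    (Sum.elim .source <| Sum.elim (fun x => .guard x.1 x.2.1 x.2.2) <|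
      Sum.elim .link <| Sum.elim .apex .sink) ?_
  rintro (v | ⟨x, y, k⟩ | k | k | v)
  · exact ⟨.inl v, rfl⟩
  · exact ⟨.inr (.inl (x, y, k)), rfl⟩
  · exact ⟨.inr (.inr (.inl k)), rfl⟩
  · exact ⟨.inr (.inr (.inr (.inl k))), rfl⟩
  · exact ⟨.inr (.inr (.inr (.inr v))), rfl⟩

/-- Glue `D` and `E`: all arcs lead from `D` to `E`, from `D` to the guards and links, and from the
apices to `E`. The two links and the two apices form a transitive tournament, and each guard leads
to one link and two vertices of `E`. -/
def glue {A B : Type} (D : Digraph A) (E : Digraph B) : Digraph (GadgetVertex A B) :=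
  ⟨fun x y => match x, y with
    | .source u, .source v => D.Adj u v
    | .source _, .guard _ _ _ => True
    | .source _, .link _ => True
    | .source _, .sink _ => True
    | .guard _ _ k, .link l => l = k
    | .guard x y _, .sink v => v = x ∨ v = y
    | .link k, .link l => k = false ∧ l = true
    | .link _, .apex _ => True
    | .apex k, .apex l => k = false ∧ l = true
    | .apex _, .sink _ => True
    | .sink u, .sink v => E.Adj u v
    | _, _ => False⟩

theorem glue_acyclic {A B : Type} [Finite A] {D : Digraph A} {E : Digraph B}
    {r : A → ℕ} (hr : ∀ u v, D.Adj u v → r u < r v)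
    {t : B → ℕ} (ht : ∀ u v, E.Adj u v → t u < t v) : (D.glue E).Acyclic := by
  obtain ⟨N, hN⟩ := (Set.finite_range r).bddAbove
  have hN : ∀ v, r v ≤ N := fun v => hN ⟨v, rfl⟩
  refine Acyclic.of_rank (fun
    | .source v => r v
    | .guard _ _ _ => N + 1
    | .link k => N + 2 + k.toNat
    | .apex k => N + 4 + k.toNat
    | .sink v => N + 6 + t v) ?_
  have hb : ∀ k : Bool, k.toNat ≤ 1 := Bool.toNat_le
  rintro (u | ⟨x, y, k⟩ | k | k | u) (v | ⟨x', y', l⟩ | l | l | v) h <;>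
    first
    | exact h.elim
    | exact hr _ _ h
    | (have := hN u; dsimp only; omega)
    | (have := ht _ _ h; dsimp only; omega)
    | (have := hb k; dsimp only; omega)
    | (obtain ⟨rfl, rfl⟩ := h; simp)

theorem ncard_le_three_of_subset {α : Type*} {S : Set α} (a b c : α)
    (h : ∀ x ∈ S, x = a ∨ x = b ∨ x = c) : S.ncard ≤ 3 := by
  classical
  have hS : S ⊆ (({a, b, c} : Finset α) : Set α) := fun x hx => by simpa using h x hx
  have h1 := Set.ncard_le_ncard hS
  rw [Set.ncard_coe_finset] at h1
  exact h1.trans Finset.card_le_three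

/-- Sources receive arcs only from sources and sinks send arcs only to sinks, so gluing keeps those
degrees. Guards and links have outdegree at most 3, apices indegree at most 3. -/
theorem glue_inClass {A B : Type} [Finite A] [Finite B] {D : Digraph A} {E : Digraph B}
    {r : A → ℕ} (hr : ∀ u v, D.Adj u v → r u < r v)
    {t : B → ℕ} (ht : ∀ u v, E.Adj u v → t u < t v)
    (hD : ∀ v, D.indeg v ≤ 4) (hE : ∀ v, E.outdeg v ≤ 3) : (D.glue E).InClass 4 3 := by
  refine ⟨glue_acyclic hr ht, ?_⟩
  rintro (v | ⟨x, y, k⟩ | k | k | v)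
  · left
    have : {x | (D.glue E).Adj x (.source v)} = GadgetVertex.source '' {u | D.Adj u v} := by
      ext (u | ⟨x', y', l⟩ | l | l | u) <;> simp [glue]
    rw [indeg, this, Set.ncard_image_of_injective _ fun _ _ h => GadgetVertex.source.inj h]
    exact_mod_cast hD v
  · right
    have : (D.glue E).outdeg (.guard x y k) ≤ 3 := by
      refine ncard_le_three_of_subset (.link k) (.sink x) (.sink y) ?_
      rintro (u | ⟨x', y', l⟩ | l | l | u) h <;> simp_all [glue]
    exact_mod_cast this
  · right
    have : (D.glue E).outdeg (.link k) ≤ 3 := by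
      refine ncard_le_three_of_subset (.link true) (.apex true) (.apex false) ?_
      rintro (u | ⟨x', y', l⟩ | l | l | u) h <;> simp_all [glue]
    exact_mod_cast this
  · left
    have : (D.glue E).indeg (.apex k) ≤ 3 := by
      refine ncard_le_three_of_subset (.link true) (.link false) (.apex false) ?_
      rintro (u | ⟨x', y', l⟩ | l | l | u) h <;> simp_all [glue]
    exact_mod_cast this.trans (by norm_num)
  · right
    have : {x | (D.glue E).Adj (.sink v) x} = GadgetVertex.sink '' {u | E.Adj v u} := by
      ext (u | ⟨x', y', l⟩ | l | l | u) <;> simp [glue]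
    rw [outdeg, this, Set.ncard_image_of_injective _ fun _ _ h => GadgetVertex.sink.inj h]
    exact_mod_cast hE v

theorem subset_pair_of_not_subset_compl {p q : Fin 4} {n : Finset (Fin 4)}
    (hn : n.card ≤ 1 ∨ n = {p, q}) (h : ∀ r, r ≠ p → r ≠ q → ¬ n ⊆ {r}) : n ⊆ {p, q} := by
  rcases hn with hn | rfl
  · intro x hx
    by_contra hxpq
    simp only [Finset.mem_insert, Finset.mem_singleton, not_or] at hxpq
    refine h x hxpq.1 hxpq.2 fun y hy => ?_
    exact Finset.mem_singleton.2 (Finset.card_le_one.1 hn y hy x hx)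
  · exact subset_rfl

theorem exists_others :
    ∀ p q : Fin 4, p ≠ q → ∃ r s, ∀ x, x ≠ p → x ≠ q → x = r ∨ x = s := by
  decide

theorem not_classCoveredByCuts_four_three : ¬ ClassCoveredByCuts 4 3 4 := by
  intro hcov
  obtain ⟨A, _, D, rD, hrD, hD, hforceD⟩ := exists_forces_antichain 4 4
  obtain ⟨B, _, E, rE, hrE, hE, hforceE⟩ := exists_forces_antichain_of_outdeg 3 4
  obtain ⟨f, hf⟩ := (coveredByCuts_iff _ _).1
    (hcov _ (D.glue E) (glue_inClass hrD hrE hD hE))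
  obtain ⟨M, hM, hMa, hMf⟩ := hforceD (fun v => f (.source v)) fun u v huv => hf _ _ huv
  obtain ⟨N, hN, hNa, hNf⟩ := hforceE (fun v => f (.sink v)) fun u v huv => hf _ _ huv
  obtain ⟨p, q, hpq, hpair⟩ := exists_pair_of_antichain hM hMa
  have hsmall : ∀ x, (∀ v, (D.glue E).Adj (.source v) x) → (f x).card ≤ 1 ∨ f x = {p, q} := by
    intro x hx
    refine card_le_one_or_eq_pair p q hpq _ fun m hm hm2 => ?_
    by_contra hne
    obtain ⟨v, rfl⟩ := hMf m (hpair m hm2 hne)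
    exact hf _ _ (hx v) hm
  have hsink : ∀ i, ∃ v, f (.sink v) = {i} := fun i =>
    hNf _ (singleton_mem_of_antichain hN hNa (fun n hn => by
      obtain ⟨v, rfl⟩ := hNf n hn
      exact hsmall (.sink v) fun _ => trivial) i)
  choose b hb using hsink
  obtain ⟨r, s, hrs⟩ := exists_others p q hpq
  -- The guard aimed at the sinks labelled `{r}` and `{s}` cannot have a label inside either of
  -- these singletons.
  have hguard : ∀ k, f (.guard (b r) (b s) k) ⊆ {p, q} := fun k => by
    refine subset_pair_of_not_subset_compl (hsmall _ fun _ => trivial) fun x hxp hxq => ?_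
    have hx : x = r ∨ x = s := hrs x hxp hxq
    rw [← hb x]
    exact hf (.guard (b r) (b s) k) (.sink (b x)) (hx.imp (congrArg b) (congrArg b))
  -- The guard below `{p, q}` keeps a link from being labelled `{p, q}`; its arc to an apex keeps
  -- its label nonempty.
  have hlink : ∀ k, ∃ i, f (.link k) = {i} := fun k => by
    have hle : (f (.link k)).card ≤ 1 := (hsmall (.link k) fun _ => trivial).resolve_right fun h =>
      hf (.guard (b r) (b s) k) (.link k) rfl (h ▸ hguard k)
    have hpos : (f (.link k)).Nonempty := by
      rw [Finset.nonempty_iff_ne_empty]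
      intro h
      exact hf (.link k) (.apex true) trivial (h ▸ Finset.empty_subset _)
    exact Finset.card_eq_one.1 (le_antisymm hle hpos.card_pos)
  choose c hc using hlink
  have hcc : c false ≠ c true := fun h =>
    hf (.link false) (.link true) ⟨rfl, rfl⟩ (by rw [hc, hc, h])
  have hcard : (({c false, c true} : Finset (Fin 4))ᶜ).card = 2 := by
    rw [Finset.card_compl, Finset.card_pair hcc, Fintype.card_fin]
  -- An apex avoids both link singletons, and it needs two elements because every singleton occurs
  -- at a sink. So both apices get the same label, despite the arc between them.
  have hapex : ∀ l, f (.apex l) = {c false, c true}ᶜ := fun l => by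
    have hnot : ∀ k, c k ∉ f (.apex l) := fun k hk =>
      hf (.link k) (.apex l) trivial (by rwa [hc, Finset.singleton_subset_iff])
    refine Finset.eq_of_subset_of_card_le (fun x hx => ?_) ?_
    · rw [Finset.mem_compl, Finset.mem_insert, Finset.mem_singleton]
      rintro (rfl | rfl)
      · exact hnot _ hx
      · exact hnot _ hx
    · rw [hcard]
      by_contra! hlt
      obtain ⟨i, hi⟩ := Finset.card_le_one_iff_subset_singleton.1 (Nat.le_of_lt_succ hlt)
      exact hf (.apex l) (.sink (b i)) trivial (by rwa [hb])
  exact hf (.apex false) (.apex true) ⟨rfl, rfl⟩ (by rw [hapex, hapex])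

end Digraph

/-! ### The threshold for four cuts -/

theorem theorem2p4 :
    Digraph.cutCoverNumber 5 2 ≤ 4 ∧
    Digraph.cutCoverNumber 3 3 ≤ 4 ∧
    4 < Digraph.cutCoverNumber 6 (-1) ∧
    4 < Digraph.cutCoverNumber 4 3 ∧
    ∀ Δin Δout : ℤ, -1 ≤ Δin → -1 ≤ Δout →
      (Digraph.cutCoverNumber Δin Δout ≤ 4 ↔
        (Δin ≤ 5 ∧ Δout ≤ 2) ∨ (Δin ≤ 2 ∧ Δout ≤ 5) ∨ (Δin ≤ 3 ∧ Δout ≤ 3)) := by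
  have key : ∀ m n : ℤ, Digraph.cutCoverNumber m n ≤ 4 ↔ Digraph.ClassCoveredByCuts m n 4 :=
    fun m n => Digraph.cutCoverNumber_le_iff (k := 4)
  refine ⟨(key _ _).2 Digraph.classCoveredByCuts_five_two,
    (key _ _).2 Digraph.classCoveredByCuts_three_three,
    not_le.1 fun h => Digraph.not_classCoveredByCuts_six ((key _ _).1 h),
    not_le.1 fun h => Digraph.not_classCoveredByCuts_four_three ((key _ _).1 h),
    fun m n hm hn => (key m n).trans ⟨fun h => ?_, ?_⟩⟩
  · have h1 : ¬ 6 ≤ m := fun h6 => Digraph.not_classCoveredByCuts_six (h.mono h6 hn)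
    have h2 : ¬ 6 ≤ n := fun h6 => Digraph.not_classCoveredByCuts_six (h.symm.mono h6 hm)
    have h3 : ¬ (4 ≤ m ∧ 3 ≤ n) := fun h4 =>
      Digraph.not_classCoveredByCuts_four_three (h.mono h4.1 h4.2)
    have h4 : ¬ (4 ≤ n ∧ 3 ≤ m) := fun h4 =>
      Digraph.not_classCoveredByCuts_four_three (h.symm.mono h4.1 h4.2)
    omega
  · rintro (⟨h1, h2⟩ | ⟨h1, h2⟩ | ⟨h1, h2⟩)
    · exact Digraph.classCoveredByCuts_five_two.mono h1 h2
    · exact Digraph.classCoveredByCuts_five_two.symm.mono h1 h2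
    · exact Digraph.classCoveredByCuts_three_three.mono h1 h2
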